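/- For an integer $q\ge 1$, let $\mathcal K_q$ be the complete graph on $q$ vertices. Define graphs $\mathcal G_q(g)$, $g\ge 0$, by $\mathcal G_q(0)=\mathcal K_{q+2}$ and, for $g\ge 0$, let $\mathcal G_q(g+1)=\mathcal G_q(g)\circledcirc\mathcal K_q$ be the edge corona product: for every edge of $\mathcal G_q(g)$ introduce a new copy of $\mathcal K_q$ and connect all its vertices to both end vertices of that edge. Consider the simple random walk on $\mathcal G_q(g)$ (at each step the walker moves to a uniformly chosen neighbour of its current vertex), let $\pi$ be its stationary distribution, and for vertices $i,j$ let $H_{ij}$ be the expected time at which the walk started at $i$ first reaches $j$ (so $H_{ii}=0$). The mean hitting time (Kemeny constant) of $\mathcal G_q(g)$ is $H_q(g)=\sum_{j}\pi_j H_{ij}$. Then for all $q\ge 1$, all $g\ge 0$ and every starting vertex $i$, this quantity is finite, does not depend on $i$, and equals $$H_q(g)=\left[\frac{(q+1)^2}{q+2}-\frac{3(q+1)}{2}\right](q+1)^g+\frac{(q+1)(3q+7)}{2(q+3)}\left[\frac{(q+1)(q+2)}{2}\right]^g+\frac{q+1}{q+3}.$$ -/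

import Mathlib

open MeasureTheory ProbabilityTheory
open scoped ENNReal

/-- The edge corona of `G` and `H`: one copy of `G` and, for every edge `e` of `G`, one copy
`{e} × W` of `H`, every vertex of which is joined to both end vertices of `e`. -/
def edgeCorona {V W : Type} (G : SimpleGraph V) (H : SimpleGraph W) :
    SimpleGraph (V ⊕ (G.edgeSet × W)) where
  Adj
    | Sum.inl u, Sum.inl v => G.Adj u v
    | Sum.inl u, Sum.inr (e, _) => u ∈ (e : Sym2 V)
    | Sum.inr (e, _), Sum.inl u => u ∈ (e : Sym2 V)
    | Sum.inr (e, w), Sum.inr (f, x) => e = f ∧ H.Adj w x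
  symm := ⟨by
    rintro (u | ⟨e, w⟩) (v | ⟨f, x⟩) h
    · exact G.adj_symm h
    · exact h
    · exact h
    · exact ⟨h.1.symm, H.adj_symm h.2⟩⟩
  loopless := ⟨by
    rintro (u | ⟨e, w⟩) h
    · exact G.loopless.irrefl u h
    · exact H.loopless.irrefl w h.2⟩

/-- The iterated edge coronas with `K_q`, starting from `K_{q+2}`: vertex type and graph. -/
def simplicialNetworkAux (q : ℕ) : ℕ → (V : Type) × SimpleGraph V
  | 0 => ⟨Fin (q + 2), ⊤⟩
  | g + 1 => ⟨_, edgeCorona (simplicialNetworkAux q g).2 (⊤ : SimpleGraph (Fin q))⟩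

/-- The vertex set of `G_q(g)`. -/
def NetworkVertex (q g : ℕ) : Type := (simplicialNetworkAux q g).1

/-- The graph `G_q(g)`. -/
def simplicialNetwork (q g : ℕ) : SimpleGraph (NetworkVertex q g) := (simplicialNetworkAux q g).2

theorem networkVertex_finite (q g : ℕ) : Finite (NetworkVertex q g) := by
  induction g with
  | zero => exact inferInstanceAs (Finite (Fin (q + 2)))
  | succ g ih =>
    have : Finite (simplicialNetworkAux q g).1 := ih
    exact inferInstanceAs (Finite
      ((simplicialNetworkAux q g).1 ⊕ ((simplicialNetworkAux q g).2.edgeSet × Fin q)))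

noncomputable instance (q g : ℕ) : Fintype (NetworkVertex q g) :=
  @Fintype.ofFinite _ (networkVertex_finite q g)

noncomputable instance (q g : ℕ) : DecidableRel (simplicialNetwork q g).Adj :=
  Classical.decRel _

instance (q g : ℕ) : MeasurableSpace (NetworkVertex q g) := ⊤

instance (q g : ℕ) : DiscreteMeasurableSpace (NetworkVertex q g) := ⟨fun _ => trivial⟩

namespace RandomWalk

variable {V : Type} [Fintype V] (G : SimpleGraph V) [DecidableRel G.Adj]

/-- One step of the simple random walk from `v`: a uniformly chosen neighbour of `v`.
(By convention the walk stays at `v` if `v` is isolated.) -/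
noncomputable def step (v : V) : PMF V :=
  if h : (G.neighborFinset v).Nonempty then PMF.uniformOfFinset (G.neighborFinset v) h
  else PMF.pure v

/-- A stationary distribution of the random walk on `G`. -/
def IsStationary (π : PMF V) : Prop := π.bind (step G) = π

theorem step_apply {u v : V} (h : G.Adj u v) (w : V) :
    step G u w = if G.Adj u w then ((G.degree u : ℝ≥0∞))⁻¹ else 0 := by
  have hn : (G.neighborFinset u).Nonempty := ⟨v, by simpa using h⟩
  simp [step, hn, PMF.uniformOfFinset_apply, SimpleGraph.card_neighborFinset_eq_degree]

/-- A graph with at least one edge has a stationary distribution, namely `d_v / ∑ d_w`. -/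
theorem exists_isStationary (h : ∃ u v, G.Adj u v) : ∃ π : PMF V, IsStationary G π := by
  obtain ⟨u, v, huv⟩ := h
  have hpos : 0 < G.degree u := by
    rw [← SimpleGraph.card_neighborFinset_eq_degree]
    exact Finset.card_pos.2 ⟨v, by simpa using huv⟩
  have h0 : ∑' w, (G.degree w : ℝ≥0∞) ≠ 0 := by
    intro h0
    have := ENNReal.tsum_eq_zero.1 h0 u
    simp at this
    omega
  have htop : ∑' w, (G.degree w : ℝ≥0∞) ≠ ∞ := by
    rw [tsum_fintype]
    exact (ENNReal.sum_lt_top.2 fun w _ => ENNReal.natCast_lt_top _).ne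
  refine ⟨PMF.normalize _ h0 htop, ?_⟩
  ext w
  rw [PMF.bind_apply]
  simp only [PMF.normalize_apply]
  have key : ∀ x, (G.degree x : ℝ≥0∞) * (∑' w, (G.degree w : ℝ≥0∞))⁻¹ * step G x w =
      (if G.Adj w x then 1 else 0) * (∑' w, (G.degree w : ℝ≥0∞))⁻¹ := by
    intro x
    by_cases hd : G.degree x = 0
    · have hx : ¬ G.Adj w x := by
        intro hwx
        rw [← SimpleGraph.card_neighborFinset_eq_degree, Finset.card_eq_zero] at hd
        have : w ∈ G.neighborFinset x := by simpa using hwx.symm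
        simp [hd] at this
      simp [hd, hx]
    · obtain ⟨y, hy⟩ : (G.neighborFinset x).Nonempty := by
        rw [← Finset.card_pos, SimpleGraph.card_neighborFinset_eq_degree]; omega
      rw [step_apply G (v := y) (by simpa using hy), mul_right_comm]
      simp only [SimpleGraph.adj_comm G x w]
      split_ifs
      · rw [ENNReal.mul_inv_cancel (by simpa using hd) (ENNReal.natCast_ne_top _)]
      · simp
  simp_rw [key]
  rw [ENNReal.tsum_mul_right]
  congr 1
  rw [tsum_fintype, Finset.sum_boole, ← SimpleGraph.card_neighborFinset_eq_degree]
  congr 2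
  ext x; simp

section Law

variable [MeasurableSpace V] [DiscreteMeasurableSpace V]

/-- The transition kernel of the random walk: given the trajectory up to time `n`, the position
at time `n + 1` is distributed as one step from the position at time `n`. -/
noncomputable def transition (n : ℕ) : Kernel (Π _ : Finset.Iic n, V) V :=
  (Kernel.ofFunOfCountable fun v => (step G v).toMeasure).comap
    (fun x => x ⟨n, Finset.mem_Iic.2 le_rfl⟩) (measurable_pi_apply _)

instance (n : ℕ) : IsMarkovKernel (transition G n) := by
  constructor
  intro x
  change IsProbabilityMeasure (step G _).toMeasure
  infer_instance

/-- The law, on the space of trajectories `ℕ → V`, of the random walk on `G` started at `i`. -/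
noncomputable def law (i : V) : Measure (ℕ → V) :=
  Kernel.trajMeasure (X := fun _ => V) (Measure.dirac i) (transition G)

/-- The first time at which the trajectory `x` is at `j` (`∞` if it never is). -/
noncomputable def firstHit (j : V) (x : ℕ → V) : ℝ≥0∞ :=
  ⨅ (n : ℕ) (_ : x n = j), (n : ℝ≥0∞)

/-- The hitting time `H i j`: the expected time at which the walk started at `i` first reaches
`j`. -/
noncomputable def hittingTime (i j : V) : ℝ≥0∞ := ∫⁻ x, firstHit j x ∂(law G i)

/-- The expected time for the walk started at `i` to reach a target vertex that is chosen
according to `π`. -/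
noncomputable def meanHittingTime (π : PMF V) (i : V) : ℝ≥0∞ :=
  ∑ j, π j * hittingTime G i j

end Law

end RandomWalk

/-! Everything reduces to linear algebra over the reals. A matrix `H` with zero diagonal that solves
the first-step equations must be the matrix of hitting times (`hittingTime_eq_ofReal`), so it
suffices to write one down. `IsHittingMatrix` adds the diagonal equation, which encodes the mean
return time, total degree over degree. It makes `H` a Green function: harmonic functions are
constant, hence the Kemeny sum does not depend on the start, and the stationary law is unique
(`stationary_toReal`).

The edge corona admits an explicit solution `coronaHitting` built from `H`: old-to-old times scale
by `q + 1`, and values at new vertices are forced by their own first-step equations. Summing over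
targets leaves a sum of commute times over edges, which Foster's theorem (`sum_edge_commute`)
evaluates as `(n - 1) * totalDegree`. With `M` the total degree and `n` the order, this gives `K' =
(q+1) K + q(q+1)/(2(q+2)) (3M/2 - n)`, solved from the complete graph upwards. -/

namespace RandomWalk

variable {V : Type} [Fintype V] (G : SimpleGraph V) [DecidableRel G.Adj]
  [MeasurableSpace V] [DiscreteMeasurableSpace V]

/-! ### Hitting times of the trajectory measure and first-step equations -/

instance (i : V) : IsProbabilityMeasure (law G i) := by
  unfold law; infer_instance

theorem law_map_zero (i : V) : (law G i).map (fun x => x 0) = Measure.dirac i := by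
  have h : (fun x : ℕ → V => x 0) =
      (fun y : (Π _ : Finset.Iic 0, V) => y ⟨0, Finset.mem_Iic.2 le_rfl⟩) ∘
        Preorder.frestrictLe (π := fun _ => V) 0 := rfl
  have hm : Measurable (fun y : (Π _ : Finset.Iic 0, V) => y ⟨0, Finset.mem_Iic.2 le_rfl⟩) :=
    measurable_pi_apply _
  rw [h, ← Measure.map_map hm (by fun_prop), law, Kernel.trajMeasure,
    Measure.map_comp _ _ (by fun_prop), Kernel.traj_map_frestrictLe, Kernel.partialTraj_self,
    Measure.id_comp, Measure.map_map hm (MeasurableEquiv.measurable _), Measure.map_dirac]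
  rfl

/-- The probability that the walk started at `i` is at `k` at time `n` and has not visited `j` up to
time `n`. -/
noncomputable def avoid (i j : V) (n : ℕ) (k : V) : ℝ≥0∞ :=
  law G i {x | x n = k ∧ ∀ m ≤ n, x m ≠ j}

theorem measurableSet_avoid {V : Type} [MeasurableSpace V] [DiscreteMeasurableSpace V]
    (j : V) (n : ℕ) : MeasurableSet {x : ℕ → V | ∀ m ≤ n, x m ≠ j} := by
  have : {x : ℕ → V | ∀ m ≤ n, x m ≠ j} = ⋂ m, ⋂ (_ : m ≤ n), (fun x => x m) ⁻¹' {j}ᶜ := by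
    ext; simp
  rw [this]
  exact .iInter fun m => .iInter fun _ => measurable_pi_apply m (.of_discrete)

theorem measurableSet_at {V : Type} [MeasurableSpace V] [DiscreteMeasurableSpace V] (n : ℕ) (k : V) : MeasurableSet {x : ℕ → V | x n = k} :=
  measurable_pi_apply (X := fun _ : ℕ => V) n (MeasurableSet.of_discrete (s := {k}))

theorem sum_avoid (i j : V) (n : ℕ) :
    ∑ k, avoid G i j n k = law G i {x | ∀ m ≤ n, x m ≠ j} := by
  have : {x : ℕ → V | ∀ m ≤ n, x m ≠ j} = ⋃ k, {x | x n = k ∧ ∀ m ≤ n, x m ≠ j} := by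
    ext x; simp
  rw [this, measure_iUnion, tsum_fintype]
  · rfl
  · intro k l hkl
    refine Set.disjoint_left.2 ?_
    rintro x ⟨rfl, -⟩ ⟨h, -⟩
    exact hkl h
  · exact fun k => (measurableSet_at n k).inter (measurableSet_avoid j n)

theorem avoid_zero_of_ne {i j : V} (h : i ≠ j) (k : V) :
    avoid G i j 0 k = Measure.dirac i {k} := by
  have h1 : avoid G i j 0 k = (law G i).map (fun x => x 0) ({k} ∩ {j}ᶜ) := by
    rw [Measure.map_apply (measurable_pi_apply 0) (.of_discrete), avoid]
    congr 1
    ext x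
    simp
  rw [h1, law_map_zero, Measure.dirac_apply, Measure.dirac_apply]
  by_cases hk : i = k
  · subst hk; simp [h]
  · simp [hk]

theorem avoid_self (i j : V) (n : ℕ) : avoid G i j n j = 0 := by
  have : {x : ℕ → V | x n = j ∧ ∀ m ≤ n, x m ≠ j} = ∅ := by
    ext x
    simp only [Set.mem_ofPred_eq, Set.mem_empty_iff_false, iff_false]
    exact fun h => h.2 n le_rfl h.1
  rw [avoid, this, measure_empty]

/-- The Markov property: the joint law of the past and the next position is the composition product
of the law of the past with the kernel. Since `k ≠ j`, avoiding `j` at time `n + 1` is automatic. -/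
theorem avoid_succ (i j : V) (n : ℕ) {k : V} (hk : k ≠ j) :
    avoid G i j (n + 1) k = ∑ l, avoid G i j n l * step G l k := by
  set A : Set (Π _ : Finset.Iic n, V) := {y | ∀ m, y m ≠ j} with hA
  have hAm : MeasurableSet A := .of_discrete
  have hpre : Preorder.frestrictLe (π := fun _ => V) n ⁻¹' A = {x : ℕ → V | ∀ m ≤ n, x m ≠ j} := by
    ext x; simp [hA]
  have key := congrArg (fun μ => μ (A ×ˢ {k}))
    (Kernel.map_frestrictLe_trajMeasure_compProd_eq_map_trajMeasure (X := fun _ => V)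
      (μ₀ := Measure.dirac i) (κ := transition G) (a := n))
  rw [Measure.compProd_apply_prod hAm .of_discrete,
    Measure.map_apply (by fun_prop) (hAm.prod .of_discrete),
    setLIntegral_map hAm (Kernel.measurable_coe _ .of_discrete) (by fun_prop), hpre] at key
  change ∫⁻ x in _, (step G (x n)).toMeasure {k} ∂(law G i) = law G i _ at key
  have hl : avoid G i j (n + 1) k = law G i
      ((fun x : ℕ → V => (Preorder.frestrictLe (π := fun _ => V) n x, x (n + 1))) ⁻¹'
        (A ×ˢ {k})) := by
    rw [avoid]
    congr 1
    ext x
    simp only [Set.mem_ofPred_eq, Set.mem_preimage, Set.mem_prod, Set.mem_singleton_iff, hA,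
      Preorder.frestrictLe_apply, Subtype.forall, Finset.mem_Iic]
    constructor
    · exact fun h => ⟨fun m hm => h.2 m (by omega), h.1⟩
    · refine fun h => ⟨h.2, fun m hm => ?_⟩
      rcases Nat.lt_or_ge n m with h' | h'
      · obtain rfl : m = n + 1 := by omega
        rw [h.2]; exact hk
      · exact h.1 m h'
  rw [hl, ← key]
  have hs : ∀ x : ℕ → V, (step G (x n)).toMeasure {k} =
      ∑ l, Set.indicator {x : ℕ → V | x n = l} (fun _ => step G l k) x := by
    intro x
    rw [PMF.toMeasure_apply_singleton _ _ .of_discrete, Finset.sum_eq_single (x n)]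
    · simp
    · intro l _ hl
      simp [Ne.symm hl]
    · simp
  simp_rw [hs]
  rw [lintegral_finsetSum _ fun l _ => measurable_const.indicator (measurableSet_at n l)]
  refine Finset.sum_congr rfl fun l _ => ?_
  rw [lintegral_indicator_const (measurableSet_at n l),
    Measure.restrict_apply (measurableSet_at n l), mul_comm]
  rfl

/-- A time `T` is the sum over `n` of the indicators of `T > n`; both sides are infinite when `j` is
never reached. -/
theorem firstHit_eq_tsum {V : Type} (j : V) (x : ℕ → V) :
    firstHit j x = ∑' n, Set.indicator {x : ℕ → V | ∀ m ≤ n, x m ≠ j} 1 x := by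
  classical
  by_cases h : ∃ n, x n = j
  · have hi : ∀ n, Set.indicator {x : ℕ → V | ∀ m ≤ n, x m ≠ j} (1 : (ℕ → V) → ℝ≥0∞) x =
        if n < Nat.find h then 1 else 0 := by
      intro n
      simp [Set.indicator_apply, Nat.lt_find_iff]
    simp_rw [hi]
    rw [tsum_eq_sum (s := Finset.range (Nat.find h)) (by intro b hb; simpa using hb),
      Finset.sum_congr rfl (g := fun _ => 1) (by intro b hb; simpa using hb)]
    simp only [Finset.sum_const, Finset.card_range, nsmul_eq_mul, mul_one]
    refine le_antisymm (iInf₂_le (f := fun n (_ : x n = j) => (n : ℝ≥0∞)) _ (Nat.find_spec h)) (le_iInf₂ fun n hn => ?_)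
    exact_mod_cast Nat.find_min' h hn
  · push Not at h
    have hi : ∀ n, Set.indicator {x : ℕ → V | ∀ m ≤ n, x m ≠ j} (1 : (ℕ → V) → ℝ≥0∞) x = 1 := by
      intro n
      simp [h]
    simp_rw [hi]
    rw [ENNReal.tsum_const_eq_top_of_ne_zero one_ne_zero]
    simp [firstHit, h]

theorem hittingTime_eq_tsum (i j : V) :
    hittingTime G i j = ∑' n, ∑ k, avoid G i j n k := by
  simp_rw [sum_avoid, hittingTime, firstHit_eq_tsum]
  rw [lintegral_tsum fun n => (measurable_one.indicator (measurableSet_avoid j n)).aemeasurable]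
  refine tsum_congr fun n => ?_
  rw [lintegral_indicator_one (measurableSet_avoid j n)]

theorem avoid_ne_top (i j : V) (n : ℕ) (k : V) : avoid G i j n k ≠ ∞ := measure_ne_top _ _

theorem hittingTime_self (j : V) : hittingTime G j j = 0 := by
  have : ∀ n, ∑ k, avoid G j j n k = 0 := by
    intro n
    rw [sum_avoid]
    refine measure_mono_null (t := {x : ℕ → V | x 0 ≠ j}) (fun x hx => hx 0 (Nat.zero_le _)) ?_
    have h := congrArg (fun μ => μ {j}ᶜ) (law_map_zero G j)
    rw [Measure.map_apply (measurable_pi_apply 0) .of_discrete] at h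
    exact h.trans (by simp)
  simp [hittingTime_eq_tsum, this]

/-- A real solution of the first-step equations for the target `j` is the vector of hitting times
of `j`; in particular these are finite. -/
theorem hittingTime_eq_ofReal {j : V} {h : V → ℝ} (hj : h j = 0)
    (hh : ∀ i, i ≠ j → h i = 1 + ∑ k, (step G i k).toReal * h k) (i : V) :
    hittingTime G i j ≠ ∞ ∧ (hittingTime G i j).toReal = h i := by
  by_cases hij : i = j
  · subst hij
    simp [hittingTime_self, hj]
  set w : ℕ → V → ℝ := fun n k => (avoid G i j n k).toReal with hw
  have hw0 : ∀ n k, 0 ≤ w n k := fun _ _ => ENNReal.toReal_nonneg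
  have hwj : ∀ n, w n j = 0 := fun n => by simp [hw, avoid_self]
  -- Pairing the killed walk with `h` loses exactly the surviving mass at each step, so the identity
  -- telescopes in `hsum`.
  have hstep : ∀ n, ∑ k, w n k * h k = ∑ k, w n k + ∑ k, w (n + 1) k * h k := by
    intro n
    have h1 : ∀ k, w n k * h k = w n k + ∑ l, w n k * (step G k l).toReal * h l := by
      intro k
      by_cases hk : k = j
      · simp [hk, hwj]
      · rw [hh k hk, mul_add, mul_one, Finset.mul_sum]
        simp [mul_assoc]
    have h2 : ∀ l, w (n + 1) l * h l = ∑ k, w n k * (step G k l).toReal * h l := by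
      intro l
      by_cases hl : l = j
      · simp [hl, hj]
      · rw [← Finset.sum_mul]
        congr 1
        simp only [hw]
        rw [avoid_succ G i j n hl, ENNReal.toReal_sum fun k _ =>
          ENNReal.mul_ne_top (avoid_ne_top G _ _ _ _) (PMF.apply_ne_top _ _)]
        simp [ENNReal.toReal_mul]
    rw [Finset.sum_congr rfl fun k _ => h1 k, Finset.sum_add_distrib, Finset.sum_comm,
      Finset.sum_congr rfl fun k _ => h2 k]
  have hinit : ∑ k, w 0 k * h k = h i := by
    rw [Finset.sum_eq_single i]
    · simp [hw, avoid_zero_of_ne G hij]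
    · intro k _ hk
      simp [hw, avoid_zero_of_ne G hij, Ne.symm hk]
    · simp
  set S : ℕ → ℝ := fun n => ∑ k, w n k with hS
  have hsum : ∀ N, h i = ∑ n ∈ Finset.range N, S n + ∑ k, w N k * h k := by
    intro N
    induction N with
    | zero => simp [hinit]
    | succ N ih => rw [ih, hstep N, Finset.sum_range_succ, add_assoc]
  have hS0 : ∀ n, 0 ≤ S n := fun n => Finset.sum_nonneg fun k _ => hw0 n k
  have hSlaw : ∀ n, ∑ k, avoid G i j n k = ENNReal.ofReal (S n) := by
    intro n
    rw [hS, ENNReal.ofReal_sum_of_nonneg fun k _ => hw0 n k]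
    simp [hw, ENNReal.ofReal_toReal (avoid_ne_top G _ _ _ _)]
  have hS1 : ∀ n, S n ≤ 1 := by
    intro n
    have := hSlaw n
    rw [sum_avoid] at this
    have h1 : ENNReal.ofReal (S n) ≤ 1 := this ▸ prob_le_one
    simpa using h1
  set M : ℝ := ∑ k, |h k| with hM
  have hM0 : 0 ≤ M := Finset.sum_nonneg fun _ _ => abs_nonneg _
  have hbound : ∀ n, |∑ k, w n k * h k| ≤ S n * M := by
    intro n
    refine (Finset.abs_sum_le_sum_abs _ _).trans ?_
    rw [hS, Finset.sum_mul]
    refine Finset.sum_le_sum fun k _ => ?_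
    rw [abs_mul, abs_of_nonneg (hw0 n k)]
    exact mul_le_mul_of_nonneg_left
      (Finset.single_le_sum (f := fun k => |h k|) (fun _ _ => abs_nonneg _) (Finset.mem_univ k))
      (hw0 n k)
  -- The remainder is at most `M` because survival probabilities are at most 1, which bounds the
  -- partial sums. Summability then forces `S N → 0`, and the same bound kills the remainder; no
  -- connectivity is needed.
  have hsummable : Summable S := by
    refine summable_of_sum_range_le (c := h i + M) hS0 fun N => ?_
    have h1 := hsum N
    have h2 := (abs_le.1 (hbound N)).1
    have h3 : S N * M ≤ 1 * M := mul_le_mul_of_nonneg_right (hS1 N) hM0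
    linarith
  have hzero : Filter.Tendsto (fun N => ∑ k, w N k * h k) Filter.atTop (nhds 0) := by
    refine squeeze_zero_norm hbound ?_
    simpa using hsummable.tendsto_atTop_zero.mul_const M
  have htsum : ∑' n, S n = h i := by
    have h1 : Filter.Tendsto (fun N => ∑ n ∈ Finset.range N, S n) Filter.atTop
        (nhds (h i - 0)) :=
      (tendsto_const_nhds.sub hzero).congr fun N => by linarith [hsum N]
    rw [sub_zero] at h1
    exact tendsto_nhds_unique hsummable.hasSum.tendsto_sum_nat h1
  have : hittingTime G i j = ENNReal.ofReal (h i) := by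
    rw [hittingTime_eq_tsum, ← htsum, ENNReal.ofReal_tsum_of_nonneg hS0 hsummable]
    exact tsum_congr hSlaw
  have hi0 : 0 ≤ h i := htsum ▸ tsum_nonneg hS0
  rw [this]
  exact ⟨ENNReal.ofReal_ne_top, ENNReal.toReal_ofReal hi0⟩

end RandomWalk

/-! ### Adjacency sums, incidence identities and the hitting equations -/

open scoped Classical in
/-- The sum of `φ` over the neighbours of `i`. -/
noncomputable def neighborSum {V : Type} [Fintype V] (G : SimpleGraph V) (φ : V → ℝ) (i : V) : ℝ :=
  ∑ k, if G.Adj i k then φ k else 0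

/-- The degree of `i`, as a real number. -/
noncomputable def realDegree {V : Type} [Fintype V] (G : SimpleGraph V) (i : V) : ℝ :=
  neighborSum G (fun _ => 1) i

/-- The sum of all degrees. -/
noncomputable def totalDegree {V : Type} [Fintype V] (G : SimpleGraph V) : ℝ := ∑ i, realDegree G i

open scoped Classical in
/-- The sum of `φ` over the end vertices of `e`. -/
noncomputable def endSum {V : Type} [Fintype V] (e : Sym2 V) (φ : V → ℝ) : ℝ :=
  ∑ u, if u ∈ e then φ u else 0

open scoped Classical in
/-- `H` solves the first-step equations for the hitting times of the walk on `G`. -/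
structure IsHittingMatrix {V : Type} [Fintype V] (G : SimpleGraph V) (H : V → V → ℝ) : Prop where
  diag : ∀ j, H j j = 0
  neighborSum_eq : ∀ i j, neighborSum G (fun k => H k j) i =
    realDegree G i * (H i j - 1) + if i = j then totalDegree G else 0

/-- The hitting time from `i` to a target chosen proportionally to the degrees. -/
noncomputable def kemeny {V : Type} [Fintype V] (G : SimpleGraph V) (H : V → V → ℝ) (i : V) : ℝ :=
  (∑ j, realDegree G j * H i j) / totalDegree G

section Graph

variable {V : Type} [Fintype V] (G : SimpleGraph V)

theorem neighborSum_add (φ ψ : V → ℝ) (i : V) :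
    neighborSum G (fun k => φ k + ψ k) i = neighborSum G φ i + neighborSum G ψ i := by
  classical
  simp_rw [neighborSum, ← Finset.sum_add_distrib]
  exact Finset.sum_congr rfl fun k _ => by split_ifs <;> simp

theorem neighborSum_sub (φ ψ : V → ℝ) (i : V) :
    neighborSum G (fun k => φ k - ψ k) i = neighborSum G φ i - neighborSum G ψ i := by
  classical
  simp_rw [neighborSum, ← Finset.sum_sub_distrib]
  exact Finset.sum_congr rfl fun k _ => by split_ifs <;> simp

theorem neighborSum_const_mul (c : ℝ) (φ : V → ℝ) (i : V) :
    neighborSum G (fun k => c * φ k) i = c * neighborSum G φ i := by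
  classical
  simp_rw [neighborSum, Finset.mul_sum, mul_ite, mul_zero]

theorem neighborSum_const (c : ℝ) (i : V) :
    neighborSum G (fun _ => c) i = c * realDegree G i := by
  simpa [realDegree] using neighborSum_const_mul G c (fun _ => 1) i

theorem neighborSum_sum {ι : Type} (s : Finset ι) (φ : ι → V → ℝ) (i : V) :
    neighborSum G (fun k => ∑ a ∈ s, φ a k) i = ∑ a ∈ s, neighborSum G (φ a) i := by
  classical
  simp_rw [neighborSum]
  rw [Finset.sum_comm]
  exact Finset.sum_congr rfl fun k _ => by split_ifs <;> simp

theorem sum_neighborSum_mul (φ ψ : V → ℝ) :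
    ∑ i, neighborSum G φ i * ψ i = ∑ i, φ i * neighborSum G ψ i := by
  classical
  simp_rw [neighborSum, Finset.sum_mul, Finset.mul_sum]
  rw [Finset.sum_comm]
  refine Finset.sum_congr rfl fun i _ => Finset.sum_congr rfl fun k _ => ?_
  simp only [G.adj_comm k i]
  split_ifs <;> simp

theorem realDegree_eq_degree [DecidableRel G.Adj] (i : V) : realDegree G i = G.degree i := by
  classical
  rw [realDegree, neighborSum, ← SimpleGraph.card_neighborFinset_eq_degree,
    SimpleGraph.neighborFinset_eq_filter, Finset.card_filter]
  push_cast
  congr!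

theorem realDegree_nonneg (i : V) : 0 ≤ realDegree G i := by
  classical
  rw [realDegree_eq_degree]
  exact Nat.cast_nonneg _

theorem endSum_const_mul (c : ℝ) (e : Sym2 V) (φ : V → ℝ) :
    endSum e (fun u => c * φ u) = c * endSum e φ := by
  classical
  simp_rw [endSum, Finset.mul_sum, mul_ite, mul_zero]

theorem endSum_add (e : Sym2 V) (φ ψ : V → ℝ) :
    endSum e (fun u => φ u + ψ u) = endSum e φ + endSum e ψ := by
  classical
  simp_rw [endSum, ← Finset.sum_add_distrib]
  exact Finset.sum_congr rfl fun k _ => by split_ifs <;> simp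

variable {G} in
theorem endSum_one {e : Sym2 V} (he : e ∈ G.edgeSet) : endSum e (fun _ => 1) = 2 := by
  classical
  induction e with
  | _ u v =>
    have huv : u ≠ v := ((SimpleGraph.mem_edgeSet G).1 he).ne
    rw [endSum, Finset.sum_boole]
    have : (Finset.univ.filter fun x => x ∈ s(u, v)) = {u, v} := by ext; simp
    rw [this, Finset.card_pair huv]
    norm_num

variable {G} in
theorem endSum_const {e : Sym2 V} (he : e ∈ G.edgeSet) (c : ℝ) :
    endSum e (fun _ => c) = 2 * c := by
  have := endSum_const_mul c e (fun _ => 1)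
  rw [endSum_one he] at this
  simpa [mul_comm] using this

variable [Fintype G.edgeSet]

-- The unsigned incidence matrix `B` satisfies `B Bᵀ = A + D`: distinct vertices share at most one
-- edge, and a vertex lies on as many edges as its degree.
open scoped Classical in
theorem sum_edge_mem_mem (u v : V) :
    (∑ e : G.edgeSet, if u ∈ (e : Sym2 V) ∧ v ∈ (e : Sym2 V) then (1 : ℝ) else 0) =
      (if G.Adj u v then 1 else 0) + if u = v then realDegree G u else 0 := by
  by_cases huv : u = v
  · subst huv
    rw [realDegree_eq_degree, ← SimpleGraph.card_incidenceFinset_eq_degree]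
    simp only [and_self, SimpleGraph.irrefl, if_false, zero_add, if_true]
    rw [Finset.sum_boole, Nat.cast_inj]
    refine Finset.card_bij (fun e _ => (e : Sym2 V)) ?_ ?_ ?_
    · intro e he
      rw [SimpleGraph.mem_incidenceFinset]
      exact ⟨e.2, (Finset.mem_filter.1 he).2⟩
    · exact fun a _ b _ h => Subtype.ext h
    · intro e he
      rw [SimpleGraph.mem_incidenceFinset] at he
      exact ⟨⟨e, he.1⟩, by simpa using he.2, rfl⟩
  · simp only [Sym2.mem_and_mem_iff huv, huv, if_false, add_zero]
    by_cases h : G.Adj u v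
    · rw [Finset.sum_eq_single ⟨s(u, v), h⟩]
      · simp [h]
      · intro e _ he
        exact if_neg fun h' => he (Subtype.ext h')
      · simp
    · rw [if_neg h]
      refine Finset.sum_eq_zero fun e _ => if_neg fun h' => h ?_
      have := e.2
      rwa [h'] at this

open scoped Classical in
theorem sum_edge_mem (u : V) :
    (∑ e : G.edgeSet, if u ∈ (e : Sym2 V) then (1 : ℝ) else 0) = realDegree G u := by
  simpa using sum_edge_mem_mem G u u

open scoped Classical in
theorem sum_edge_mem_endSum (φ : V → ℝ) (i : V) :
    (∑ e : G.edgeSet, if i ∈ (e : Sym2 V) then endSum (e : Sym2 V) φ else 0) =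
      realDegree G i * φ i + neighborSum G φ i := by
  have h : ∀ e : G.edgeSet, (if i ∈ (e : Sym2 V) then endSum (e : Sym2 V) φ else 0) =
      ∑ u, (if i ∈ (e : Sym2 V) ∧ u ∈ (e : Sym2 V) then 1 else 0) * φ u := by
    intro e
    by_cases hi : i ∈ (e : Sym2 V) <;> simp [hi, endSum]
  simp_rw [h]
  rw [Finset.sum_comm]
  simp_rw [← Finset.sum_mul, sum_edge_mem_mem, add_mul, Finset.sum_add_distrib]
  simp [neighborSum, add_comm]

theorem sum_edge_endSum (φ : V → ℝ) :
    ∑ e : G.edgeSet, endSum (e : Sym2 V) φ = ∑ u, realDegree G u * φ u := by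
  classical
  simp_rw [endSum]
  rw [Finset.sum_comm]
  refine Finset.sum_congr rfl fun u _ => ?_
  rw [← sum_edge_mem, Finset.sum_mul]
  simp

theorem card_edgeSet_eq : (Fintype.card G.edgeSet : ℝ) = totalDegree G / 2 := by
  have h := sum_edge_endSum G (fun _ => 1)
  simp_rw [mul_one, fun e : G.edgeSet => endSum_one e.2] at h
  rw [totalDegree, ← h]
  simp

theorem sum_edge_endSum_endSum (H : V → V → ℝ) :
    ∑ e : G.edgeSet, endSum (e : Sym2 V) (fun v => endSum (e : Sym2 V) fun u => H u v) =
      ∑ v, (realDegree G v * H v v + neighborSum G (fun u => H u v) v) := by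
  classical
  simp_rw [fun v => (sum_edge_mem_endSum G (fun u => H u v) v).symm]
  rw [Finset.sum_comm]
  rfl

end Graph

/-! ### Consequences of the hitting equations -/

namespace IsHittingMatrix

variable {V : Type} [Fintype V] {G : SimpleGraph V} {H : V → V → ℝ}

/-- The degree-weighted row sum is harmonic: the diagonal term at `j = i` cancels the total of the
`-1` terms. -/
theorem neighborSum_degree_sum (hH : IsHittingMatrix G H) (i : V) :
    neighborSum G (fun k => ∑ j, realDegree G j * H k j) i =
      realDegree G i * ∑ j, realDegree G j * H i j := by
  classical
  rw [neighborSum_sum]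
  simp_rw [neighborSum_const_mul, hH.neighborSum_eq, mul_add, Finset.sum_add_distrib]
  have h1 : ∑ j, realDegree G j * (realDegree G i * (H i j - 1)) =
      realDegree G i * ∑ j, realDegree G j * H i j - realDegree G i * totalDegree G := by
    rw [totalDegree, Finset.mul_sum, Finset.mul_sum, ← Finset.sum_sub_distrib]
    exact Finset.sum_congr rfl fun j _ => by ring
  rw [h1]
  simp

/-- Harmonic functions are constant, because the Green function exists. -/
theorem eq_of_harmonic (hH : IsHittingMatrix G H) (hpos : 0 < totalDegree G) {f : V → ℝ}
    (hf : ∀ i, neighborSum G f i = realDegree G i * f i) (j : V) :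
    f j = (∑ i, realDegree G i * f i) / totalDegree G := by
  classical
  -- Adjacency is symmetric, so it can be moved from `f` to column `j` of `H`; the terms in `H` then
  -- cancel, leaving `f j` and the weighted sum of `f`.
  have h := sum_neighborSum_mul G f (fun i => H i j)
  simp_rw [hf, hH.neighborSum_eq] at h
  have h2 : ∑ i, f i * (realDegree G i * (H i j - 1) + if i = j then totalDegree G else 0) =
      ∑ i, realDegree G i * f i * H i j - ∑ i, realDegree G i * f i + f j * totalDegree G := by
    simp_rw [mul_add, Finset.sum_add_distrib, ← Finset.sum_sub_distrib]
    congr 1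
    · exact Finset.sum_congr rfl fun i _ => by ring
    · simp
  rw [h2] at h
  rw [eq_div_iff hpos.ne']
  linarith

theorem kemeny_eq (hH : IsHittingMatrix G H) (hpos : 0 < totalDegree G) (i j : V) :
    kemeny G H i = kemeny G H j := by
  rw [kemeny, kemeny, hH.eq_of_harmonic hpos hH.neighborSum_degree_sum i,
    hH.eq_of_harmonic hpos hH.neighborSum_degree_sum j]

/-- Foster's theorem, in terms of commute times. -/
theorem sum_edge_commute (hH : IsHittingMatrix G H) [Fintype G.edgeSet] :
    ∑ e : G.edgeSet, endSum (e : Sym2 V) (fun v => endSum (e : Sym2 V) fun u => H u v) =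
      (Fintype.card V - 1) * totalDegree G := by
  classical
  rw [sum_edge_endSum_endSum]
  -- Only the diagonal equations enter, each with right-hand side `totalDegree G` minus the degree.
  simp_rw [hH.neighborSum_eq, hH.diag]
  simp only [mul_zero, zero_add, zero_sub, mul_neg, mul_one, if_true]
  rw [Finset.sum_add_distrib, Finset.sum_neg_distrib, Finset.sum_const, Finset.card_univ,
    nsmul_eq_mul]
  change -totalDegree G + _ = _
  ring

/-- At an isolated vertex the diagonal equation would read `0 = totalDegree G`. -/
theorem realDegree_pos (hH : IsHittingMatrix G H) (hpos : 0 < totalDegree G) (i : V) :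
    0 < realDegree G i := by
  classical
  refine (realDegree_nonneg G i).lt_of_ne fun h => ?_
  have h0 : ∀ k, ¬ G.Adj i k := by
    intro k hk
    rw [realDegree_eq_degree] at h
    have : 0 < G.degree i := (G.degree_pos_iff_exists_adj i).2 ⟨k, hk⟩
    have h' : (G.degree i : ℝ) ≠ 0 := by exact_mod_cast this.ne'
    exact h' h.symm
  have h1 := hH.neighborSum_eq i i
  rw [← h, neighborSum] at h1
  simp [h0] at h1
  exact hpos.ne h1

end IsHittingMatrix

/-! ### Hitting times and Kemeny recursion for the edge corona -/

section Corona

variable {V : Type} [Fintype V] {G : SimpleGraph V} [Fintype G.edgeSet] {q : ℕ}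

open scoped Classical in
theorem neighborSum_edgeCorona_inl (F : V ⊕ (G.edgeSet × Fin q) → ℝ) (i : V) :
    neighborSum (edgeCorona G (⊤ : SimpleGraph (Fin q))) F (Sum.inl i) =
      neighborSum G (fun k => F (Sum.inl k)) i +
        ∑ e : G.edgeSet, if i ∈ (e : Sym2 V) then ∑ w, F (Sum.inr (e, w)) else 0 := by
  rw [neighborSum, Fintype.sum_sum_type, Fintype.sum_prod_type]
  congr 1
  refine Finset.sum_congr rfl fun e _ => ?_
  by_cases h : i ∈ (e : Sym2 V) <;> simp [edgeCorona, h]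

theorem neighborSum_edgeCorona_inr (F : V ⊕ (G.edgeSet × Fin q) → ℝ) (e : G.edgeSet) (w : Fin q) :
    neighborSum (edgeCorona G (⊤ : SimpleGraph (Fin q))) F (Sum.inr (e, w)) =
      endSum (e : Sym2 V) (fun k => F (Sum.inl k)) + ∑ x, F (Sum.inr (e, x)) -
        F (Sum.inr (e, w)) := by
  classical
  rw [neighborSum, Fintype.sum_sum_type, Fintype.sum_prod_type, add_sub_assoc]
  congr 1
  · simp [edgeCorona, endSum]
  rw [Finset.sum_eq_single e]
  · rw [eq_sub_iff_add_eq, ← Finset.sum_erase_add _ _ (Finset.mem_univ w),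
      ← Finset.sum_erase_add (f := fun x => F (Sum.inr (e, x))) _ (Finset.mem_univ w)]
    congr 1
    rw [Finset.sum_congr rfl (g := fun x => F (Sum.inr (e, x)))]
    · simp [edgeCorona]
    · intro x hx
      simp [edgeCorona, (Finset.ne_of_mem_erase hx).symm]
  · intro f _ hf
    simp [edgeCorona, hf.symm]
  · simp

theorem realDegree_edgeCorona_inl (i : V) :
    realDegree (edgeCorona G (⊤ : SimpleGraph (Fin q))) (Sum.inl i) =
      (q + 1) * realDegree G i := by
  classical
  rw [realDegree, neighborSum_edgeCorona_inl, ← realDegree]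
  have := sum_edge_mem G i
  simp only [Finset.sum_const, Finset.card_univ, Fintype.card_fin, nsmul_eq_mul, mul_one]
  rw [← this, add_mul, one_mul, add_comm, Finset.mul_sum]
  simp

theorem realDegree_edgeCorona_inr (p : G.edgeSet × Fin q) :
    realDegree (edgeCorona G (⊤ : SimpleGraph (Fin q))) (Sum.inr p) = q + 1 := by
  obtain ⟨e, w⟩ := p
  rw [realDegree, neighborSum_edgeCorona_inr, endSum_one e.2]
  simp
  ring

/-- Each old edge together with its copy spans a `K_{q+2}`, and these cliques partition the edges.
-/
theorem totalDegree_edgeCorona :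
    totalDegree (edgeCorona G (⊤ : SimpleGraph (Fin q))) =
      (q + 1) * (q + 2) / 2 * totalDegree G := by
  rw [totalDegree, Fintype.sum_sum_type]
  simp_rw [realDegree_edgeCorona_inl, realDegree_edgeCorona_inr]
  rw [← Finset.mul_sum, ← totalDegree, Finset.sum_const, Finset.card_univ, Fintype.card_prod,
    nsmul_eq_mul, Nat.cast_mul, card_edgeSet_eq, Fintype.card_fin]
  ring

theorem card_edgeCorona :
    (Fintype.card (V ⊕ (G.edgeSet × Fin q)) : ℝ) = Fintype.card V + q * totalDegree G / 2 := by
  rw [Fintype.card_sum, Fintype.card_prod, Nat.cast_add, Nat.cast_mul, card_edgeSet_eq,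
    Fintype.card_fin]
  ring

/-- The extension to the edge corona of a function on `G`, by the first-step equations at the new
vertices. -/
noncomputable def coronaExtend (φ : V → ℝ) : V ⊕ (G.edgeSet × Fin q) → ℝ
  | Sum.inl i => φ i
  | Sum.inr (e, _) => (q + 1) / 2 + endSum (e : Sym2 V) φ / 2

open scoped Classical in
/-- The correction to the first-step equations that makes the new vertex `p` the target. -/
noncomputable def coronaBump (p : G.edgeSet × Fin q) : V ⊕ (G.edgeSet × Fin q) → ℝ
  | Sum.inl _ => 0
  | Sum.inr (e, x) => if e = p.1 then 1 + 2 * (if x = p.2 then 1 else 0) else 0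

theorem neighborSum_coronaExtend_inl (φ : V → ℝ) (i : V) :
    neighborSum (edgeCorona G (⊤ : SimpleGraph (Fin q))) (coronaExtend φ) (Sum.inl i) =
      (q + 2) / 2 * neighborSum G φ i + q / 2 * realDegree G i * φ i +
        q * (q + 1) / 2 * realDegree G i := by
  classical
  rw [neighborSum_edgeCorona_inl]
  have h : ∀ e : G.edgeSet, (if i ∈ (e : Sym2 V) then
      ∑ w : Fin q, coronaExtend φ (Sum.inr (e, w)) else 0) =
      q * (q + 1) / 2 * (if i ∈ (e : Sym2 V) then 1 else 0) +
        q / 2 * (if i ∈ (e : Sym2 V) then endSum (e : Sym2 V) φ else 0) := by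
    intro e
    simp only [coronaExtend, Finset.sum_const, Finset.card_univ, Fintype.card_fin, nsmul_eq_mul]
    split_ifs <;> ring
  simp_rw [h]
  rw [Finset.sum_add_distrib, ← Finset.mul_sum, ← Finset.mul_sum, sum_edge_mem,
    sum_edge_mem_endSum]
  simp only [coronaExtend]
  ring

/-- The extension is constant on each copy; its value `c` is the solution of `endSum + (q - 1) c =
(q + 1)(c - 1)`. -/
theorem neighborSum_coronaExtend_inr (φ : V → ℝ) (p : G.edgeSet × Fin q) :
    neighborSum (edgeCorona G (⊤ : SimpleGraph (Fin q))) (coronaExtend φ) (Sum.inr p) =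
      (q + 1) * (coronaExtend φ (Sum.inr p) - 1) := by
  obtain ⟨e, w⟩ := p
  rw [neighborSum_edgeCorona_inr]
  simp only [coronaExtend, Finset.sum_const, Finset.card_univ, Fintype.card_fin, nsmul_eq_mul]
  ring

omit [Fintype V] [Fintype G.edgeSet] in
open scoped Classical in
theorem sum_coronaBump (p : G.edgeSet × Fin q) (e : G.edgeSet) :
    ∑ x, coronaBump p (Sum.inr (e, x)) = if e = p.1 then (q : ℝ) + 2 else 0 := by
  simp only [coronaBump]
  split_ifs <;> simp [Finset.sum_add_distrib]

open scoped Classical in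
theorem neighborSum_coronaBump_inl (p : G.edgeSet × Fin q) (i : V) :
    neighborSum (edgeCorona G (⊤ : SimpleGraph (Fin q))) (coronaBump p) (Sum.inl i) =
      if i ∈ (p.1 : Sym2 V) then (q : ℝ) + 2 else 0 := by
  rw [neighborSum_edgeCorona_inl]
  simp_rw [sum_coronaBump]
  rw [Finset.sum_eq_single p.1]
  · simp [coronaBump, neighborSum]
  · intro e _ he
    simp [he]
  · simp

-- The weights 3 at `p` and 1 on the rest of its copy make the defect vanish at every new vertex
-- except `p`. Scaled by `(q + 1) * totalDegree G / 4`, the defect at `p` is the total degree of the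
-- corona.
open scoped Classical in
theorem neighborSum_coronaBump_inr (p r : G.edgeSet × Fin q) :
    neighborSum (edgeCorona G (⊤ : SimpleGraph (Fin q))) (coronaBump p) (Sum.inr r) =
      (q + 1) * coronaBump p (Sum.inr r) - if r = p then 2 * ((q : ℝ) + 2) else 0 := by
  obtain ⟨e, x⟩ := r
  rw [neighborSum_edgeCorona_inr, sum_coronaBump]
  simp only [coronaBump, endSum, ite_self, Finset.sum_const_zero, zero_add, Prod.ext_iff]
  by_cases h1 : e = p.1 <;> by_cases h2 : x = p.2 <;> simp [h1, h2] <;> ring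

/-- The hitting time in the edge corona from the old vertex `i` to a new vertex attached to the
edge `e`, expressed by the hitting times `H` of `G`. -/
noncomputable def edgeTarget (q : ℕ) (H : V → V → ℝ) (e : G.edgeSet) (i : V) : ℝ :=
  (q + 1) * (endSum (e : Sym2 V) (H i) / 2 + ((3 / 2 * totalDegree G - 1) / 2 -
    endSum (e : Sym2 V) (fun v => endSum (e : Sym2 V) fun u => H u v) / 4))

theorem endSum_comm (e f : Sym2 V) (H : V → V → ℝ) :
    endSum e (fun v => endSum f fun u => H u v) = endSum f (fun u => endSum e fun v => H u v) := by
  classical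
  simp_rw [endSum, ← Finset.sum_filter]
  exact Finset.sum_comm

omit [Fintype G.edgeSet] in
theorem endSum_edgeTarget (H : V → V → ℝ) (e : G.edgeSet) :
    endSum (e : Sym2 V) (edgeTarget q H e) = (q + 1) * (3 / 2 * totalDegree G - 1) := by
  unfold edgeTarget
  rw [endSum_const_mul, endSum_add, endSum_const e.2, endSum_comm]
  have := endSum_const_mul (1 / 2) (e : Sym2 V) (fun u => endSum (e : Sym2 V) fun v => H u v)
  simp_rw [show ∀ u, endSum (e : Sym2 V) (H u) / 2 = 1 / 2 * endSum (e : Sym2 V) (H u) from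
    fun u => by ring]
  rw [this]
  ring

/-- The hitting times of the edge corona. -/
noncomputable def coronaHitting (q : ℕ) (H : V → V → ℝ) :
    V ⊕ (G.edgeSet × Fin q) → V ⊕ (G.edgeSet × Fin q) → ℝ
  | x, Sum.inl j => coronaExtend (fun i => (q + 1) * H i j) x
  | x, Sum.inr p => coronaExtend (edgeTarget q H p.1) x -
      (q + 1) * totalDegree G / 4 * coronaBump p x

omit [Fintype G.edgeSet] in
theorem IsHittingMatrix.neighborSum_endSum {H : V → V → ℝ} (hH : IsHittingMatrix G H)
    (e : G.edgeSet) (i : V) [Decidable (i ∈ (e : Sym2 V))] :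
    neighborSum G (fun k => endSum (e : Sym2 V) (H k)) i =
      realDegree G i * (endSum (e : Sym2 V) (H i) - 2) +
        if i ∈ (e : Sym2 V) then totalDegree G else 0 := by
  classical
  simp_rw [endSum, ← Finset.sum_filter]
  rw [neighborSum_sum]
  simp_rw [hH.neighborSum_eq]
  rw [Finset.sum_add_distrib, ← Finset.mul_sum, Finset.sum_sub_distrib]
  have h := endSum_one e.2
  rw [endSum, ← Finset.sum_filter] at h
  rw [h]
  simp

omit [Fintype G.edgeSet] in
theorem IsHittingMatrix.neighborSum_edgeTarget {H : V → V → ℝ} (hH : IsHittingMatrix G H)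
    (e : G.edgeSet) (i : V) [Decidable (i ∈ (e : Sym2 V))] :
    neighborSum G (edgeTarget q H e) i =
      realDegree G i * (edgeTarget q H e i - (q + 1)) +
        (q + 1) / 2 * if i ∈ (e : Sym2 V) then totalDegree G else 0 := by
  unfold edgeTarget
  rw [neighborSum_const_mul, neighborSum_add, neighborSum_const]
  simp_rw [show ∀ u, endSum (e : Sym2 V) (H u) / 2 = 1 / 2 * endSum (e : Sym2 V) (H u) from
    fun u => by ring]
  rw [neighborSum_const_mul, hH.neighborSum_endSum]
  ring

theorem IsHittingMatrix.edgeCorona {H : V → V → ℝ} (hH : IsHittingMatrix G H) :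
    IsHittingMatrix (edgeCorona G (⊤ : SimpleGraph (Fin q))) (coronaHitting q H) := by
  classical
  constructor
  · rintro (j | p)
    · simp [coronaHitting, coronaExtend, hH.diag]
    · obtain ⟨e, w⟩ := p
      simp only [coronaHitting, coronaExtend, coronaBump, endSum_edgeTarget, if_true]
      -- The additive constant in `edgeTarget` is chosen for this cancellation; the other equations
      -- are insensitive to it.
      ring
  · rintro i (j | p)
    · simp only [coronaHitting]
      rcases i with i | r
      · rw [neighborSum_coronaExtend_inl, neighborSum_const_mul, hH.neighborSum_eq,
          realDegree_edgeCorona_inl, totalDegree_edgeCorona]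
        simp only [coronaExtend, Sum.inl.injEq]
        split_ifs <;> ring
      · rw [neighborSum_coronaExtend_inr, realDegree_edgeCorona_inr]
        simp
    · simp only [coronaHitting]
      rw [neighborSum_sub, neighborSum_const_mul]
      rcases i with i | r
      · rw [neighborSum_coronaExtend_inl, neighborSum_coronaBump_inl, hH.neighborSum_edgeTarget,
          realDegree_edgeCorona_inl]
        simp only [coronaExtend, coronaBump, reduceCtorEq, if_false]
        -- At the ends of the target edge, the source term of `edgeTarget` cancels the contribution
        -- of the bump.
        split_ifs <;> ring
      · rw [neighborSum_coronaExtend_inr, neighborSum_coronaBump_inr, realDegree_edgeCorona_inr,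
          totalDegree_edgeCorona]
        simp only [Sum.inr.injEq]
        split_ifs <;> ring

/-- The recursion for the mean hitting time under the edge corona with a complete graph. -/
theorem IsHittingMatrix.kemeny_edgeCorona {H : V → V → ℝ} (hH : IsHittingMatrix G H)
    (hpos : 0 < totalDegree G) (i : V) :
    kemeny (_root_.edgeCorona G (⊤ : SimpleGraph (Fin q))) (coronaHitting q H) (Sum.inl i) =
      (q + 1) * kemeny G H i +
        q * (q + 1) / (2 * (q + 2)) * (3 / 2 * totalDegree G - Fintype.card V) := by
  -- Foster's theorem enters here, through the commute-time term of `edgeTarget`.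
  have h1 : ∑ e : G.edgeSet, edgeTarget q H e i = (q + 1) / 2 * (∑ j, realDegree G j * H i j +
      totalDegree G / 2 * (3 / 2 * totalDegree G - Fintype.card V)) := by
    unfold edgeTarget
    rw [← Finset.mul_sum, Finset.sum_add_distrib, Finset.sum_sub_distrib, ← Finset.sum_div,
      ← Finset.sum_div, ← Finset.sum_div, sum_edge_endSum, hH.sum_edge_commute, Finset.sum_const, Finset.card_univ,
      nsmul_eq_mul, card_edgeSet_eq]
    ring
  have h2 : ∑ j, (↑q + 1) * realDegree G j * ((↑q + 1) * H i j) =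
      ((q : ℝ) + 1) ^ 2 * ∑ j, realDegree G j * H i j := by
    rw [Finset.mul_sum]
    exact Finset.sum_congr rfl fun j _ => by ring
  rw [kemeny, kemeny, totalDegree_edgeCorona, Fintype.sum_sum_type, Fintype.sum_prod_type]
  simp only [realDegree_edgeCorona_inl, realDegree_edgeCorona_inr, coronaHitting, coronaExtend,
    coronaBump, mul_zero, sub_zero, Finset.sum_const, Finset.card_univ, Fintype.card_fin,
    nsmul_eq_mul]
  rw [h2, ← Finset.mul_sum, ← Finset.mul_sum, h1]
  have hq : (q : ℝ) + 2 ≠ 0 := by positivity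
  have hq1 : (q : ℝ) + 1 ≠ 0 := by positivity
  have hM := hpos.ne'
  field_simp
  ring

end Corona

/-! ### The complete graph and the closed form -/

theorem neighborSum_top {V : Type} [Fintype V] (φ : V → ℝ) (i : V) :
    neighborSum (⊤ : SimpleGraph V) φ i = ∑ k, φ k - φ i := by
  classical
  rw [neighborSum, eq_sub_iff_add_eq, ← Finset.sum_erase_add _ _ (Finset.mem_univ i),
    ← Finset.sum_erase_add (f := φ) _ (Finset.mem_univ i)]
  congr 1
  rw [Finset.sum_congr rfl (g := φ)]
  · simp
  · intro x hx
    simp [(Finset.ne_of_mem_erase hx).symm]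

theorem realDegree_top {V : Type} [Fintype V] (i : V) :
    realDegree (⊤ : SimpleGraph V) i = Fintype.card V - 1 := by
  rw [realDegree, neighborSum_top]
  simp

theorem totalDegree_top {V : Type} [Fintype V] :
    totalDegree (⊤ : SimpleGraph V) = Fintype.card V * ((Fintype.card V : ℝ) - 1) := by
  simp only [totalDegree, realDegree_top, Finset.sum_const, Finset.card_univ, nsmul_eq_mul]

open scoped Classical in
theorem isHittingMatrix_top {V : Type} [Fintype V] : IsHittingMatrix (⊤ : SimpleGraph V)
    (fun i j => ((Fintype.card V : ℝ) - 1) * (1 - if i = j then 1 else 0)) := by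
  refine ⟨fun j => by simp, fun i j => ?_⟩
  rw [neighborSum_top, realDegree_top, totalDegree_top, ← Finset.mul_sum, Finset.sum_sub_distrib]
  simp only [Finset.sum_const, Finset.card_univ, Finset.sum_ite_eq', Finset.mem_univ, if_true,
    nsmul_eq_mul, mul_one]
  split_ifs <;> ring

theorem kemeny_top {V : Type} [Fintype V] (h : 1 < Fintype.card V) (i : V) [DecidableEq V] :
    kemeny (⊤ : SimpleGraph V)
      (fun i j => ((Fintype.card V : ℝ) - 1) * (1 - if i = j then 1 else 0)) i =
      ((Fintype.card V : ℝ) - 1) ^ 2 / Fintype.card V := by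
  have h1 : (1 : ℝ) < Fintype.card V := by exact_mod_cast h
  have h2 : (Fintype.card V : ℝ) - 1 ≠ 0 := by linarith
  have h3 : (Fintype.card V : ℝ) ≠ 0 := by linarith
  simp_rw [kemeny, realDegree_top, totalDegree_top]
  rw [← Finset.mul_sum, ← Finset.mul_sum, Finset.sum_sub_distrib]
  simp only [Finset.sum_const, Finset.card_univ, Finset.sum_ite_eq, Finset.mem_univ, if_true,
    nsmul_eq_mul, mul_one]
  field_simp

/-- The closed form for the mean hitting time of the walk on `simplicialNetwork q g`. -/
noncomputable def networkKemeny (q g : ℕ) : ℝ :=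
  (((q : ℝ) + 1) ^ 2 / ((q : ℝ) + 2) - 3 * ((q : ℝ) + 1) / 2) * ((q : ℝ) + 1) ^ g
    + ((q : ℝ) + 1) * (3 * (q : ℝ) + 7) / (2 * ((q : ℝ) + 3))
      * (((q : ℝ) + 1) * ((q : ℝ) + 2) / 2) ^ g
    + ((q : ℝ) + 1) / ((q : ℝ) + 3)

theorem networkKemeny_zero (q : ℕ) : networkKemeny q 0 = ((q : ℝ) + 1) ^ 2 / ((q : ℝ) + 2) := by
  have h2 : (q : ℝ) + 2 ≠ 0 := by positivity
  have h3 : (q : ℝ) + 3 ≠ 0 := by positivity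
  rw [networkKemeny]
  field_simp
  ring

theorem networkKemeny_succ (q g : ℕ) : networkKemeny q (g + 1) =
    (q + 1) * networkKemeny q g + q * (q + 1) / (2 * (q + 2)) *
      (3 / 2 * (2 * (((q : ℝ) + 1) * (q + 2) / 2) ^ (g + 1)) -
        (2 * (((q : ℝ) + 1) * (q + 2) / 2) ^ (g + 1) + 2 * (q + 2)) / (q + 3)) := by
  have h2 : (q : ℝ) + 2 ≠ 0 := by positivity
  have h3 : (q : ℝ) + 3 ≠ 0 := by positivity
  simp only [networkKemeny, pow_succ]
  generalize (((q : ℝ) + 1) * ((q : ℝ) + 2) / 2) ^ g = A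
  generalize ((q : ℝ) + 1) ^ g = B
  field_simp
  ring

/-- Total degree and order are carried along because the Kemeny recursion needs both. -/
theorem exists_isHittingMatrix_simplicialNetwork (q g : ℕ) :
    ∀ [Fintype (NetworkVertex q g)], ∃ H, IsHittingMatrix (simplicialNetwork q g) H ∧
      totalDegree (simplicialNetwork q g) = 2 * (((q : ℝ) + 1) * (q + 2) / 2) ^ (g + 1) ∧
      (Fintype.card (NetworkVertex q g) : ℝ) =
        (2 * (((q : ℝ) + 1) * (q + 2) / 2) ^ (g + 1) + 2 * (q + 2)) / (q + 3) ∧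
      ∀ i, kemeny (simplicialNetwork q g) H i = networkKemeny q g := by
  classical
  have h3 : (q : ℝ) + 3 ≠ 0 := by positivity
  induction g with
  | zero =>
    intro inst
    have hc : Fintype.card (NetworkVertex q 0) = q + 2 := by
      rw [← Nat.card_eq_fintype_card]
      exact Nat.card_fin (q + 2)
    have htop : simplicialNetwork q 0 = (⊤ : SimpleGraph (NetworkVertex q 0)) := rfl
    rw [htop]
    refine ⟨_, isHittingMatrix_top, ?_, ?_, fun i => ?_⟩
    · rw [totalDegree_top, hc]
      push_cast
      ring
    · rw [hc]
      push_cast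
      field_simp
      ring
    · rw [kemeny_top (by omega), hc, networkKemeny_zero]
      push_cast
      ring
  | succ g ih =>
    intro inst
    obtain ⟨H, hH, hM, hn, hK⟩ := ih
    have hpos : 0 < totalDegree (simplicialNetwork q g) := by
      rw [hM]; positivity
    let I : Fintype (NetworkVertex q g ⊕ ((simplicialNetwork q g).edgeSet × Fin q)) :=
      inferInstance
    -- The corona lemmas use the sum-type instance; `Fintype` is a subsingleton, so the arbitrary
    -- one may be replaced.
    obtain rfl : inst = I := Subsingleton.elim _ _
    have hH' := hH.edgeCorona (q := q)
    have hM' := totalDegree_edgeCorona (G := simplicialNetwork q g) (q := q)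
    refine ⟨coronaHitting (V := NetworkVertex q g) (G := simplicialNetwork q g) q H, hH', ?_, ?_,
      fun i => ?_⟩
    · refine hM'.trans ?_
      rw [hM]
      ring
    · refine (card_edgeCorona (G := simplicialNetwork q g) (q := q)).trans ?_
      rw [hM, hn]
      field_simp
      ring
    · have hpos' : 0 < totalDegree
          (edgeCorona (simplicialNetwork q g) (⊤ : SimpleGraph (Fin q))) := by
        rw [hM']; positivity
      obtain ⟨v⟩ : Nonempty (NetworkVertex q g) := by
        by_contra h
        rw [not_nonempty_iff] at h
        simp [totalDegree] at hpos
      -- The recursion covers old starting vertices only; independence of the start handles the new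
      -- ones.
      refine (hH'.kemeny_eq hpos' i (Sum.inl v)).trans ?_
      rw [hH.kemeny_edgeCorona hpos, hK, hM, hn, networkKemeny_succ]

/-! ### Transfer to the random walk -/

namespace RandomWalk

variable {V : Type} [Fintype V] {G : SimpleGraph V} [DecidableRel G.Adj]

theorem sum_step_mul {i : V} (hi : 0 < realDegree G i) (φ : V → ℝ) :
    ∑ k, (step G i k).toReal * φ k = neighborSum G φ i / realDegree G i := by
  classical
  rw [realDegree_eq_degree] at hi ⊢
  obtain ⟨v, hv⟩ := (G.degree_pos_iff_exists_adj i).1 (by exact_mod_cast hi)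
  rw [neighborSum, Finset.sum_div]
  refine Finset.sum_congr rfl fun k _ => ?_
  rw [step_apply G hv]
  split_ifs <;> simp [div_eq_inv_mul]

/-- Average column `j` of `H` against `π` before and after one step. Stationarity makes the averages
equal, while the equations change them by `-1 + π j * totalDegree G / realDegree G j`. -/
theorem stationary_toReal {H : V → V → ℝ} (hH : IsHittingMatrix G H) (hpos : 0 < totalDegree G)
    {π : PMF V} (hπ : IsStationary G π) (j : V) :
    (π j).toReal = realDegree G j / totalDegree G := by
  classical
  have hdeg := hH.realDegree_pos hpos
  have hstat : ∀ k, (π k).toReal = ∑ i, (π i).toReal * (step G i k).toReal := by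
    intro k
    have h := congrArg (fun μ : PMF V => (μ k).toReal) hπ
    simp only [PMF.bind_apply, tsum_fintype] at h
    rw [← h, ENNReal.toReal_sum fun i _ =>
      ENNReal.mul_ne_top (PMF.apply_ne_top _ _) (PMF.apply_ne_top _ _)]
    simp
  have htotal : ∑ i, (π i).toReal = 1 := by
    have h := π.tsum_coe
    rw [tsum_fintype] at h
    rw [← ENNReal.toReal_sum fun i _ => PMF.apply_ne_top _ _, h, ENNReal.toReal_one]
  have h1 : ∑ k, (π k).toReal * H k j =
      ∑ i, (π i).toReal * ∑ k, (step G i k).toReal * H k j := by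
    simp_rw [Finset.mul_sum]
    rw [Finset.sum_comm]
    refine Finset.sum_congr rfl fun k _ => ?_
    rw [hstat k, Finset.sum_mul]
    exact Finset.sum_congr rfl fun i _ => by ring
  have h2 : ∀ i, (π i).toReal * ∑ k, (step G i k).toReal * H k j =
      (π i).toReal * H i j - (π i).toReal +
        if i = j then (π j).toReal * (totalDegree G / realDegree G j) else 0 := by
    intro i
    rw [sum_step_mul (hdeg i) fun k => H k j, hH.neighborSum_eq, add_div,
      mul_div_cancel_left₀ _ (hdeg i).ne']
    split_ifs with h
    · subst h; ring
    · ring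
  rw [Finset.sum_congr rfl fun i _ => h2 i, Finset.sum_add_distrib, Finset.sum_sub_distrib,
    htotal] at h1
  simp only [Finset.sum_ite_eq', Finset.mem_univ, if_true] at h1
  have hj := (hdeg j).ne'
  have h3 : (π j).toReal * (totalDegree G / realDegree G j) = 1 := by linarith
  have hM := hpos.ne'
  field_simp at h3 ⊢
  linarith

theorem meanHittingTime_eq_kemeny [MeasurableSpace V] [DiscreteMeasurableSpace V]
    {H : V → V → ℝ} (hH : IsHittingMatrix G H) (hpos : 0 < totalDegree G)
    {π : PMF V} (hπ : IsStationary G π) (i : V) :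
    meanHittingTime G π i ≠ ∞ ∧ (meanHittingTime G π i).toReal = kemeny G H i := by
  have hdeg := hH.realDegree_pos hpos
  have hit : ∀ j, hittingTime G i j ≠ ∞ ∧ (hittingTime G i j).toReal = H i j := by
    intro j
    refine hittingTime_eq_ofReal G (h := fun i => H i j) (hH.diag j) (fun k hk => ?_) i
    have hk' := (hdeg k).ne'
    rw [sum_step_mul (hdeg k) fun k => H k j, hH.neighborSum_eq, if_neg hk, add_zero,
      mul_div_cancel_left₀ _ hk']
    ring
  have hfin : ∀ j ∈ Finset.univ, π j * hittingTime G i j ≠ ∞ := fun j _ =>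
    ENNReal.mul_ne_top (PMF.apply_ne_top _ _) (hit j).1
  refine ⟨ENNReal.sum_ne_top.2 hfin, ?_⟩
  rw [meanHittingTime, ENNReal.toReal_sum hfin, kemeny, Finset.sum_div]
  refine Finset.sum_congr rfl fun j _ => ?_
  rw [ENNReal.toReal_mul, (hit j).2, stationary_toReal hH hpos hπ]
  ring

end RandomWalk

theorem theorem3 (q : ℕ) (hq : 1 ≤ q) (g : ℕ) (π : PMF (NetworkVertex q g))
    (hπ : RandomWalk.IsStationary (simplicialNetwork q g) π) (i : NetworkVertex q g) :
    RandomWalk.meanHittingTime (simplicialNetwork q g) π i ≠ ∞ ∧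
    (RandomWalk.meanHittingTime (simplicialNetwork q g) π i).toReal =
      (((q : ℝ) + 1) ^ 2 / ((q : ℝ) + 2) - 3 * ((q : ℝ) + 1) / 2) * ((q : ℝ) + 1) ^ g
        + ((q : ℝ) + 1) * (3 * (q : ℝ) + 7) / (2 * ((q : ℝ) + 3))
          * (((q : ℝ) + 1) * ((q : ℝ) + 2) / 2) ^ g
        + ((q : ℝ) + 1) / ((q : ℝ) + 3) := by
  obtain ⟨H, hH, hM, -, hK⟩ := exists_isHittingMatrix_simplicialNetwork q g
  have hpos : 0 < totalDegree (simplicialNetwork q g) := by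
    rw [hM]; positivity
  obtain ⟨hfin, heq⟩ := RandomWalk.meanHittingTime_eq_kemeny hH hpos hπ i
  exact ⟨hfin, heq.trans (hK i)⟩
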